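/- Let $\Gamma=\mathbb{Z}a_1+\mathbb{Z}a_2\subset\mathbb{R}^2$ be a lattice ($a_1,a_2$ a basis of $\mathbb{R}^2$), let $a_1^*,a_2^*$ be defined by $a_i^*\cdot a_j=2\pi\delta_{ij}$, and let $|\mathbb{B}|$ be the area of the unit cell of the dual lattice spanned by $a_1^*,a_2^*$. Let $V$ be a real-valued $\Gamma$-periodic function, $k_0\in\mathbb{R}^2$, $E_0\in\mathbb{R}$, and let $u_+,u_-\in W^{2,2}(\mathbb{R}^2/\Gamma)$ be solutions of $H(k_0)u_\pm=E_0u_\pm$, where $H(k)=(-\mathrm{i}\nabla+k)^2+V$ (for instance, an orthonormal pair of eigenfunctions of the fibre Hamiltonian at a point $k_0$ where two Bloch bands meet at energy $E_0$). Let $0<\rho<r$ and let $\tilde\chi:[0,\infty)\to\mathbb{R}$ be a cutoff with $\tilde\chi(t)=1$ for $0\le t\le\rho$ and $\tilde\chi(t)=0$ for $t\ge r$. For $n\in\mathbb{Z}$ and $q\in\mathbb{R}^2\setminus\{0\}$, $q_1+\mathrm{i}q_2=|q|e^{\mathrm{i}\theta_q}$, let \[ \phi_{n,+}(q)=e^{\mathrm{i}n\theta_q/2}\begin{pmatrix}\cos(n\theta_q/2)\\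 \sin(n\theta_q/2)\end{pmatrix},\qquad \phi_n(q,x)=\phi_{n,+}(q)_1\,u_+(x)+\phi_{n,+}(q)_2\,u_-(x). \] Then $u_+$ and $u_-$ have continuous $\Gamma$-periodic representatives, and with these representatives the following hold. (a) Let $n\neq0$ and let $\tilde\chi$ be of class $C^2$. Then the $n$-canonical Wannier function \[ w_{\rm can}(x)=\frac{1}{|\mathbb{B}|^{1/2}}\int_{|k-k_0|<r}e^{\mathrm{i}k\cdot x}\,\tilde\chi(|k-k_0|)\,\phi_n(k-k_0,x)\,dk \] satisfies, for some constants $R,c>0$, \[ |w_{\rm can}(x)|\le\frac{c}{|x|^{2}}\qquad\text{for all }x\in\mathbb{R}^2\text{ with }|x|\ge R. \] (b) More generally, let $n\in\mathbb{Z}$, $j\in\{1,2\}$, $p\in\{0,1\}$, and let $\tilde\chi$ be of class $C^{p+2}$. Then \[ w_{n,p}(x)=\frac{e^{\mathrm{i}k_0\cdot x}}{|\mathbb{B}|^{1/2}}\int_{|q|<r}e^{\mathrm{i}q\cdot x}\,q_j^{\,p}\,\tilde\chi(|q|)\,\phi_n(q,x)\,dq \] satisfies, for some constants $R,c>0$,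 \[ |w_{n,p}(x)|\le\frac{c}{|x|^{p+2}}\qquad\text{for all }x\in\mathbb{R}^2\text{ with }|x|\ge R. \] -/

import Mathlib

open MeasureTheory
open scoped ContDiff RealInnerProductSpace

noncomputable section

/-- The Euclidean plane, used both for positions and for quasi-momenta. -/
abbrev Plane : Type := EuclideanSpace ℝ (Fin 2)

/-- A function on the plane that is periodic for the lattice `Γ = ℤ a₁ + ℤ a₂`. -/
def LatticePeriodic (a : Module.Basis (Fin 2) ℝ Plane) {F : Type*} (f : Plane → F) : Prop :=
  ∀ γ ∈ Submodule.span ℤ (Set.range a), ∀ x : Plane, f (x + γ) = f x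

/-- The unit cell `Y` of the lattice `Γ` spanned by `a`. -/
def unitCell (a : Module.Basis (Fin 2) ℝ Plane) : Set Plane :=
  ZSpan.fundamentalDomain a

/-- The vectors `a₁*, a₂*` determined by `aᵢ* · aⱼ = 2π δᵢⱼ`: they span the dual lattice `Γ*`. -/
def dualLatticeVector (a : Module.Basis (Fin 2) ℝ Plane) (i : Fin 2) : Plane :=
  (2 * Real.pi) •
    (InnerProductSpace.toDual ℝ Plane).symm (LinearMap.toContinuousLinearMap (a.coord i))

theorem inner_dualLatticeVector (a : Module.Basis (Fin 2) ℝ Plane) (i j : Fin 2) :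
    ⟪dualLatticeVector a i, a j⟫ = if i = j then 2 * Real.pi else 0 := by
  simp [dualLatticeVector, inner_smul_left, Finsupp.single_apply, eq_comm]

/-- The area `|𝔹|` of the unit cell `𝔹` of the dual lattice. -/
def brillouinArea (a : Module.Basis (Fin 2) ℝ Plane) : ℝ :=
  volume.real (parallelepiped (dualLatticeVector a))

/-- Membership in `L²(ℝ²/Γ)`. -/
def MemL2Torus (a : Module.Basis (Fin 2) ℝ Plane) (u : Plane → ℂ) : Prop :=
  LatticePeriodic a u ∧ MemLp u 2 (volume.restrict (unitCell a))

/-- `g` is the weak partial derivative `∂ⱼ u` on the torus `ℝ²/Γ`; the test functions are the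
smooth functions on the torus. -/
def IsWeakPartial (a : Module.Basis (Fin 2) ℝ Plane) (j : Fin 2) (u g : Plane → ℂ) : Prop :=
  ∀ φ : Plane → ℂ, ContDiff ℝ ∞ φ → LatticePeriodic a φ →
    ∫ x in unitCell a, u x * fderiv ℝ φ x (EuclideanSpace.single j 1) =
      -∫ x in unitCell a, g x * φ x

/-- `u` belongs to the Sobolev space `W^{2,2}(ℝ²/Γ)`, with first weak derivatives `D j = ∂ⱼ u` and
second weak derivatives `D2 i j = ∂ᵢ ∂ⱼ u`. -/
structure HasSobolevDerivs (a : Module.Basis (Fin 2) ℝ Plane) (u : Plane → ℂ)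
    (D : Fin 2 → Plane → ℂ) (D2 : Fin 2 → Fin 2 → Plane → ℂ) : Prop where
  mem : MemL2Torus a u
  mem_first : ∀ j, MemL2Torus a (D j)
  mem_second : ∀ i j, MemL2Torus a (D2 i j)
  first : ∀ j, IsWeakPartial a j u (D j)
  second : ∀ i j, IsWeakPartial a i (D j) (D2 i j)

/-- The fibre Hamiltonian `H(k) u = (-i∇ + k)² u + V u`, expanded as
`-∑ⱼ ∂ⱼ∂ⱼ u - 2i ∑ⱼ kⱼ ∂ⱼ u + |k|² u + V u` in terms of the weak derivatives of `u`. -/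
def fibreHamiltonian (V : Plane → ℝ) (k : Plane) (u : Plane → ℂ)
    (D : Fin 2 → Plane → ℂ) (D2 : Fin 2 → Fin 2 → Plane → ℂ) (x : Plane) : ℂ :=
  -(∑ j, D2 j j x) - 2 * Complex.I * (∑ j, (k j : ℂ) * D j x)
    + ((‖k‖ ^ 2 : ℝ) : ℂ) * u x + (V x : ℂ) * u x

/-- `u` lies in the domain `W^{2,2}(ℝ²/Γ)` of `H(k)` and solves the eigenvalue problem
`H(k) u = E u`. -/
def SolvesBlochEigenproblem (a : Module.Basis (Fin 2) ℝ Plane) (V : Plane → ℝ) (k : Plane) (E : ℝ)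
    (u : Plane → ℂ) : Prop :=
  ∃ (D : Fin 2 → Plane → ℂ) (D2 : Fin 2 → Fin 2 → Plane → ℂ),
    HasSobolevDerivs a u D D2 ∧ ∀ᵐ x, fibreHamiltonian V k u D D2 x = (E : ℂ) * u x

/-- The polar angle `θ_q`: `q₁ + i q₂ = |q| exp (i θ_q)`. -/
def polarAngle (q : Plane) : ℝ :=
  Complex.arg ((q 0 : ℂ) + (q 1 : ℂ) * Complex.I)

/-- The `n`-canonical eigenvector
`φ_{n,+}(q) = exp (i n θ_q / 2) (cos (n θ_q / 2), sin (n θ_q / 2))`. -/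
def canonicalEigenvector (n : ℤ) (q : Plane) : Fin 2 → ℂ :=
  ![Complex.exp (Complex.I * n * polarAngle q / 2) * Complex.cos (n * polarAngle q / 2),
    Complex.exp (Complex.I * n * polarAngle q / 2) * Complex.sin (n * polarAngle q / 2)]

/-- `φ_n(q, x) = φ_{n,+}(q)₁ u₊(x) + φ_{n,+}(q)₂ u₋(x)`. -/
def canonicalBloch (n : ℤ) (uP uM : Plane → ℂ) (q x : Plane) : ℂ :=
  canonicalEigenvector n q 0 * uP x + canonicalEigenvector n q 1 * uM x

/-- The `n`-canonical Wannier function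
`w_can(x) = |𝔹|^{-1/2} ∫_{|k - k₀| < r} exp (i k · x) χ(|k - k₀|) φ_n(k - k₀, x) dk`. -/
def canonicalWannier (a : Module.Basis (Fin 2) ℝ Plane) (k₀ : Plane) (r : ℝ) (χ : ℝ → ℝ) (n : ℤ)
    (uP uM : Plane → ℂ) (x : Plane) : ℂ :=
  ((1 / Real.sqrt (brillouinArea a) : ℝ) : ℂ) *
    ∫ k in Metric.ball k₀ r,
      Complex.exp (Complex.I * (⟪k, x⟫ : ℝ)) * (χ ‖k - k₀‖ : ℂ) * canonicalBloch n uP uM (k - k₀) x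

/-- The function `w_{n,p}(x) =
exp (i k₀ · x) |𝔹|^{-1/2} ∫_{|q| < r} exp (i q · x) qⱼ^p χ(|q|) φ_n(q, x) dq`. -/
def weightedWannier (a : Module.Basis (Fin 2) ℝ Plane) (k₀ : Plane) (r : ℝ) (χ : ℝ → ℝ) (n : ℤ)
    (j : Fin 2) (p : ℕ) (uP uM : Plane → ℂ) (x : Plane) : ℂ :=
  Complex.exp (Complex.I * (⟪k₀, x⟫ : ℝ)) * ((1 / Real.sqrt (brillouinArea a) : ℝ) : ℂ) *
    ∫ q in Metric.ball (0 : Plane) r,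
      Complex.exp (Complex.I * (⟪q, x⟫ : ℝ)) * ((q j : ℂ) ^ p) * (χ ‖q‖ : ℂ) *
        canonicalBloch n uP uM q x

end

/-! Both claims reduce to a product of a bounded factor and a decaying one. In two dimensions a
`W^{2,2}` function on the torus has absolutely summable Fourier coefficients, so u₊ and u₋ have
continuous periodic, hence bounded, representatives. They do not depend on q, so they come out of
the integral. What remains are the Fourier integrals of qⱼᵖ φ_{n,+}(q)ᵢ χ(|q|).

The half angles in φ_{n,+} are harmless: its components are (e^{inθ} + 1)/2 and i(1 - e^{inθ})/2, so
g = qⱼᵖ φ_{n,+}(q)ᵢ is homogeneous of degree p and smooth off the origin.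

For a smooth bump η write η = δ + η(2·). Since δ vanishes near 0, gδ is smooth with compact support.
Homogeneity turns the other term into a rescaled copy, so A, the Fourier integral of gη, satisfies
A(x) = O(|x|^{-(p+3)}) + 2^{-(p+2)} A(x/2). Thus F(x) = |x|^{p+2} |A(x)| obeys F(x) ≤ C/|x| +
F(x/2), and iterating down to the unit ball costs only a geometric sum
(`exists_pow_mul_norm_osc_bump_le`). Replacing η by χ adds a compactly supported `C^{p+2}` term,
which decays at the same rate (`exists_pow_mul_norm_osc_cutoff_le`). -/

noncomputable section
-- Sobolev embedding on the two-dimensional torus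
namespace BlochSobolev

open UnitAddTorus

attribute [local instance] instMeasureSpaceUnitAddCircle

instance isProbabilityMeasure_volume_unitAddCircle :
    IsProbabilityMeasure (volume : Measure UnitAddCircle) :=
  inferInstanceAs (IsProbabilityMeasure AddCircle.haarAddCircle)

/-- A square-integrable function on the torus with summable Fourier coefficients has a continuous
representative. -/
theorem exists_continuous_ae_eq_of_summable_mFourierCoeff {d : Type*} [Fintype d]
    {U : UnitAddTorus d → ℂ} (hU : MemLp U 2) (hs : Summable fun n => ‖mFourierCoeff U n‖) :
    ∃ G : C(UnitAddTorus d, ℂ), G =ᵐ[volume] U := by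
  have hcoeff : ∀ n, mFourierCoeff (hU.toLp U) n = mFourierCoeff U n := fun n =>
    integral_congr_ae (by filter_upwards [hU.coeFn_toLp] with t ht; rw [ht])
  have hsum : Summable fun n => mFourierCoeff U n • (mFourier n : C(UnitAddTorus d, ℂ)) := by
    refine .of_norm ?_
    simpa only [norm_smul, mFourier_norm, mul_one] using hs
  refine ⟨∑' n, mFourierCoeff U n • mFourier n, ?_⟩
  have h1 := hsum.hasSum.mapL (ContinuousMap.toLp (E := ℂ) 2 (volume : Measure (UnitAddTorus d)) ℂ)
  have h2 := hasSum_mFourier_series_L2 (hU.toLp U)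
  simp only [hcoeff] at h2
  simp only [map_smul] at h1
  -- The series converges uniformly to the candidate and in L² to `U`; uniqueness of L² limits
  -- identifies them.
  have h3 := h1.unique h2
  refine (ContinuousMap.coeFn_toLp (p := 2) (𝕜 := ℂ) volume _).symm.trans ?_
  rw [h3]
  exact hU.coeFn_toLp

theorem summable_sq_norm_mFourierCoeff {d : Type*} [Fintype d]
    {U : UnitAddTorus d → ℂ} (hU : MemLp U 2) : Summable fun n => ‖mFourierCoeff U n‖ ^ 2 := by
  have hcoeff : ∀ n, mFourierCoeff (hU.toLp U) n = mFourierCoeff U n := fun n =>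
    integral_congr_ae (by filter_upwards [hU.coeFn_toLp] with t ht; rw [ht])
  simpa only [hcoeff] using (hasSum_sq_mFourierCoeff (hU.toLp U)).summable

/-! ### Lattice coordinates and the standard torus -/

variable (a : Module.Basis (Fin 2) ℝ Plane)

/-- The parametrization of a unit cell of the lattice by the standard torus. -/
def torusParam (t : UnitAddTorus (Fin 2)) : Plane :=
  a.equivFunL.symm (measurableEquivPiIoc 0 t).1

/-- The projection of the plane to the standard torus in lattice coordinates. -/
def torusProj (x : Plane) : UnitAddTorus (Fin 2) := fun i => (a.repr x i : UnitAddCircle)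

theorem continuous_repr (i : Fin 2) : Continuous fun x : Plane => a.repr x i :=
  (a.coord i).continuous_of_finiteDimensional

theorem continuous_torusProj : Continuous (torusProj a) :=
  continuous_pi fun i => (AddCircle.continuous_mk' 1).comp (continuous_repr a i)

theorem repr_torusParam (t : UnitAddTorus (Fin 2)) (i : Fin 2) :
    a.repr (torusParam a t) i = (measurableEquivPiIoc 0 t).1 i :=
  congrFun (a.equivFunL.apply_symm_apply (measurableEquivPiIoc 0 t).1) i

theorem torusProj_torusParam (t : UnitAddTorus (Fin 2)) : torusProj a (torusParam a t) = t := by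
  funext i
  rw [torusProj, repr_torusParam]
  exact congrFun ((measurableEquivPiIoc 0).symm_apply_apply t) i

theorem repr_mem_intCast {γ : Plane} (hγ : γ ∈ Submodule.span ℤ (Set.range a)) (i : Fin 2) :
    ∃ z : ℤ, a.repr γ i = z := by
  obtain ⟨z, hz⟩ := (a.mem_span_iff_repr_mem ℤ γ).1 hγ i
  exact ⟨z, by simpa using hz.symm⟩

theorem torusProj_periodic : LatticePeriodic a (torusProj a) := by
  intro γ hγ x
  funext i
  obtain ⟨z, hz⟩ := repr_mem_intCast a hγ i
  simp only [torusProj, map_add, Finsupp.add_apply, hz]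
  rw [AddCircle.coe_add]
  simp

theorem measurableEmbedding_torusParam : MeasurableEmbedding (torusParam a) := by
  have hs : MeasurableSet {x : Fin 2 → ℝ | ∀ i, x i ∈ Set.Ioc ((0 : Fin 2 → ℝ) i) ((0 : Fin 2 → ℝ) i + 1)} :=
    MeasurableSet.univ_pi' (fun i => measurableSet_Ioc)
  exact (a.equivFunL.symm.toHomeomorph.measurableEmbedding).comp
    ((MeasurableEmbedding.subtype_coe hs).comp (measurableEquivPiIoc 0).measurableEmbedding)

/-- By uniqueness of Haar measure, the linear change to lattice coordinates rescales area by a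
nonzero constant, whose value is never needed. -/
theorem exists_measurePreserving_torusParam :
    ∃ c : NNReal, c ≠ 0 ∧
      MeasurePreserving (torusParam a) volume (c • volume.restrict (unitCell a)) := by
  set e := a.equivFunL.symm
  set S := {x : Fin 2 → ℝ | ∀ i, x i ∈ Set.Ioc ((0 : Fin 2 → ℝ) i) ((0 : Fin 2 → ℝ) i + 1)} with hS
  have hSm : MeasurableSet S := MeasurableSet.univ_pi' (fun i => measurableSet_Ioc)
  have : (Measure.map e (volume : Measure (Fin 2 → ℝ))).IsAddHaarMeasure :=
    e.isAddHaarMeasure_map volume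
  refine ⟨Measure.addHaarScalarFactor (Measure.map e volume) volume,
    (Measure.addHaarScalarFactor_pos_of_isAddHaarMeasure _ _).ne', ?_⟩
  have h1 : MeasurePreserving (fun t : UnitAddTorus (Fin 2) => (measurableEquivPiIoc 0 t).1) volume
      (volume.restrict S) := by
    refine MeasurePreserving.comp ⟨measurable_subtype_coe, ?_⟩ (measurePreserving_equivPiIoc 0)
    exact map_comap_subtype_coe hSm volume
  have he : MeasurableEmbedding e := e.toHomeomorph.measurableEmbedding
  have h2 : MeasurePreserving e (volume.restrict S)
      ((Measure.map e volume).restrict (e '' S)) :=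
    (MeasurePreserving.mk he.measurable rfl).restrict_image_emb he S
  have h3 : (Measure.map e (volume : Measure (Fin 2 → ℝ))).restrict (e '' S) =
      (Measure.map e volume).restrict (unitCell a) := by
    apply Measure.restrict_congr_set
    -- The torus is parametrized by half-open boxes (0,1]², the unit cell by [0,1)²; they differ by
    -- a null set.
    have : S =ᵐ[volume] Set.univ.pi fun i : Fin 2 => Set.Ico (0:ℝ) 1 := by
      have h4 : S = Set.univ.pi fun i : Fin 2 => Set.Ioc (0:ℝ) 1 := by
        ext x; simp [hS]
      rw [h4]
      exact (Measure.univ_pi_Ioc_ae_eq_Icc).trans (Measure.univ_pi_Ico_ae_eq_Icc).symm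
    have h5 : unitCell a = e '' (Set.univ.pi fun i : Fin 2 => Set.Ico (0:ℝ) 1) := by
      ext x
      rw [e.image_eq_preimage_symm]
      simp [unitCell, ZSpan.mem_fundamentalDomain, e]
    rw [h5]
    rw [ae_eq_set] at this ⊢
    rw [← Set.image_sdiff he.injective, ← Set.image_sdiff he.injective,
      he.map_apply, he.map_apply, Set.preimage_image_eq _ he.injective,
      Set.preimage_image_eq _ he.injective]
    exact this
  rw [h3] at h2
  have h6 := Measure.isAddLeftInvariant_eq_smul (Measure.map e volume) (volume : Measure Plane)
  rw [← Measure.restrict_smul, ← h6]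
  exact h2.comp h1

/-! ### Lattice characters and Fourier coefficients -/

/-- The lattice character with frequency `m` in lattice coordinates. -/
def latticeChar (m : Fin 2 → ℤ) (x : Plane) : ℂ :=
  Complex.exp (2 * Real.pi * Complex.I * ((∑ i, m i * a.repr x i : ℝ) : ℂ))

theorem mFourier_torusProj (m : Fin 2 → ℤ) (x : Plane) :
    mFourier m (torusProj a x) = latticeChar a m x := by
  simp only [mFourier, ContinuousMap.coe_mk, torusProj, fourier_coe_apply, latticeChar,
    Fin.prod_univ_two, Fin.sum_univ_two, ← Complex.exp_add]
  congr 1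
  push_cast
  ring

theorem latticeChar_periodic (m : Fin 2 → ℤ) : LatticePeriodic a (latticeChar a m) := by
  intro γ hγ x
  rw [← mFourier_torusProj, ← mFourier_torusProj, torusProj_periodic a γ hγ]

/-- The frequency of a lattice character as a linear form. -/
def latticeFreq (m : Fin 2 → ℤ) : Plane →L[ℝ] ℝ :=
  LinearMap.toContinuousLinearMap (∑ i, (m i : ℝ) • a.coord i)

theorem latticeFreq_apply (m : Fin 2 → ℤ) (x : Plane) :
    latticeFreq a m x = ∑ i, m i * a.repr x i := by
  simp [latticeFreq]

theorem latticeChar_eq (m : Fin 2 → ℤ) (x : Plane) :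
    latticeChar a m x = Complex.exp (2 * Real.pi * Complex.I * (latticeFreq a m x : ℂ)) := by
  rw [latticeFreq_apply]; rfl

theorem hasFDerivAt_latticeChar (m : Fin 2 → ℤ) (x : Plane) :
    HasFDerivAt (latticeChar a m) (latticeChar a m x • (2 * Real.pi * Complex.I : ℂ) •
      (Complex.ofRealCLM.comp (latticeFreq a m))) x := by
  rw [latticeChar_eq]
  have h : HasFDerivAt (fun y => ((latticeFreq a m y : ℝ) : ℂ))
      (Complex.ofRealCLM.comp (latticeFreq a m)) x :=
    (Complex.ofRealCLM.comp (latticeFreq a m)).hasFDerivAt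
  have := (h.const_mul (2 * Real.pi * Complex.I : ℂ)).cexp
  exact this.congr_of_eventuallyEq (.of_forall fun y => latticeChar_eq a m y)

theorem contDiff_latticeChar (m : Fin 2 → ℤ) : ContDiff ℝ ∞ (latticeChar a m) := by
  have : latticeChar a m =
      fun x => Complex.exp (2 * Real.pi * Complex.I * (latticeFreq a m x : ℂ)) :=
    funext (latticeChar_eq a m)
  rw [this]
  exact (contDiff_const.mul
    (Complex.ofRealCLM.contDiff.comp (latticeFreq a m).contDiff)).cexp

/-- The Fourier coefficients of a periodic function on the plane. -/
def latticeCoeff (u : Plane → ℂ) (m : Fin 2 → ℤ) : ℂ :=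
  mFourierCoeff (u ∘ torusParam a) m

theorem exists_latticeCoeff_eq_integral : ∃ c : ℝ, ∀ (u : Plane → ℂ) (m : Fin 2 → ℤ),
    latticeCoeff a u m = c * ∫ x in unitCell a, u x * latticeChar a (-m) x := by
  obtain ⟨c, -, hc⟩ := exists_measurePreserving_torusParam a
  refine ⟨c, fun u m => ?_⟩
  have h := hc.integral_comp (measurableEmbedding_torusParam a)
    (fun x => u x * latticeChar a (-m) x)
  rw [integral_smul_nnreal_measure] at h
  rw [latticeCoeff, mFourierCoeff]
  rw [NNReal.smul_def, Complex.real_smul] at h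
  refine Eq.trans (integral_congr_ae (.of_forall fun t => ?_)) h
  simp only [← mFourier_torusProj, torusProj_torusParam, smul_eq_mul, mul_comm, Function.comp]

theorem memLp_comp_torusParam {u : Plane → ℂ} (hu : MemL2Torus a u) :
    MemLp (u ∘ torusParam a) 2 := by
  obtain ⟨c, -, hc⟩ := exists_measurePreserving_torusParam a
  exact (hu.2.smul_measure (c := c) (by simp)).comp_measurePreserving hc

/-- The conjugate character is a smooth periodic function, hence an admissible test function for the
weak derivative. -/
theorem latticeCoeff_weakPartial {j : Fin 2} {u g : Plane → ℂ} (h : IsWeakPartial a j u g)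
    (m : Fin 2 → ℤ) : latticeCoeff a g m =
      2 * Real.pi * Complex.I * latticeFreq a m (EuclideanSpace.single j 1) *
        latticeCoeff a u m := by
  obtain ⟨c, hc⟩ := exists_latticeCoeff_eq_integral a
  have h1 := h _ (contDiff_latticeChar a (-m)) (latticeChar_periodic a (-m))
  have h2 : latticeFreq a (-m) (EuclideanSpace.single j 1) =
      -latticeFreq a m (EuclideanSpace.single j 1) := by
    simp [latticeFreq_apply]
  simp only [(hasFDerivAt_latticeChar a (-m) _).fderiv, smul_apply,
    ContinuousLinearMap.comp_apply, Complex.ofRealCLM_apply, h2, smul_eq_mul] at h1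
  rw [hc, hc, ← neg_eq_iff_eq_neg.2 h1, ← integral_neg]
  rw [mul_left_comm (2 * Real.pi * Complex.I * _ : ℂ) (c : ℂ)]
  congr 1
  rw [← integral_const_mul]
  refine integral_congr_ae (.of_forall fun x => ?_)
  simp only
  push_cast
  ring

/-- The integer mᵢ is the frequency form evaluated at aᵢ, so Cauchy–Schwarz in Cartesian coordinates
bounds it. -/
theorem exists_norm_le_latticeFreq : ∃ C > 0, ∀ m : Fin 2 → ℤ,
    ‖m‖ ^ 2 ≤ C * ∑ j, latticeFreq a m (EuclideanSpace.single j 1) ^ 2 := by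
  refine ⟨1 + ‖a 0‖ ^ 2 + ‖a 1‖ ^ 2, by positivity, fun m => ?_⟩
  have key : ∀ i, (m i : ℝ) ^ 2 ≤
      ‖a i‖ ^ 2 * ∑ j, latticeFreq a m (EuclideanSpace.single j 1) ^ 2 := by
    intro i
    have h1 : (m i : ℝ) = latticeFreq a m (a i) := by
      rw [latticeFreq_apply]; simp [Finsupp.single_apply]
    have h2 : a i = ∑ j, (a i j) • (EuclideanSpace.single j (1:ℝ) : Plane) := by
      ext k; fin_cases k <;> simp
    have h3 : latticeFreq a m (a i) =
        ∑ j, a i j * latticeFreq a m (EuclideanSpace.single j 1) := by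
      conv_lhs => rw [h2]
      simp
    rw [h1, h3, EuclideanSpace.real_norm_sq_eq]
    exact Finset.sum_mul_sq_le_sq_mul_sq _ _ _
  have hpos : 0 ≤ ∑ j, latticeFreq a m (EuclideanSpace.single j 1) ^ 2 :=
    Finset.sum_nonneg fun j _ => sq_nonneg _
  have hle : ‖m‖ ^ 2 ≤ (m 0 : ℝ) ^ 2 + (m 1 : ℝ) ^ 2 := by
    rw [EisensteinSeries.norm_eq_max_natAbs]
    rcases max_cases (m 0).natAbs (m 1).natAbs with h | h <;> rw [h.1] <;>
      simp only [Nat.cast_natAbs, Int.cast_abs, sq_abs] <;> nlinarith [sq_nonneg (m 0 : ℝ), sq_nonneg (m 1 : ℝ)]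
  nlinarith [key 0, key 1]

/-- The coefficients of the pure second derivatives are square-summable and dominate |m|² |û(m)| up
to a constant. Young's inequality then bounds |û(m)| by |m|⁻⁴ plus their squares, and |m|⁻⁴ is
summable over nonzero m in ℤ². -/
theorem summable_latticeCoeff {u : Plane → ℂ} {D : Fin 2 → Plane → ℂ}
    {D2 : Fin 2 → Fin 2 → Plane → ℂ} (hu : HasSobolevDerivs a u D D2) :
    Summable fun m => ‖latticeCoeff a u m‖ := by
  obtain ⟨C, hC, hfreq⟩ := exists_norm_le_latticeFreq a
  have hs : ∀ j, Summable fun m => ‖latticeCoeff a (D2 j j) m‖ ^ 2 := fun j =>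
    summable_sq_norm_mFourierCoeff (memLp_comp_torusParam a (hu.mem_second j j))
  have h4 := EisensteinSeries.summable_one_div_norm_rpow (k := 4) (by norm_num)
  have hcoeff : ∀ j m, latticeFreq a m (EuclideanSpace.single j 1) ^ 2 * ‖latticeCoeff a u m‖ ≤
      ‖latticeCoeff a (D2 j j) m‖ := by
    intro j m
    rw [latticeCoeff_weakPartial a (hu.second j j), latticeCoeff_weakPartial a (hu.first j)]
    simp only [norm_mul, Complex.norm_I, Complex.norm_real, Real.norm_eq_abs, Complex.norm_ofNat,
      abs_of_pos Real.pi_pos]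
    set κ := latticeFreq a m (EuclideanSpace.single j 1)
    rw [← sq_abs κ]
    have : (1:ℝ) ≤ (2 * Real.pi) ^ 2 := by nlinarith [Real.pi_gt_three]
    have h0 : 0 ≤ |κ| ^ 2 * ‖latticeCoeff a u m‖ := by positivity
    nlinarith
  refine Summable.of_norm_bounded_eventually
    (g := fun m => C * (‖m‖ ^ (-4 : ℝ) + (‖latticeCoeff a (D2 0 0) m‖ ^ 2 +
      ‖latticeCoeff a (D2 1 1) m‖ ^ 2)))
    ((h4.add ((hs 0).add (hs 1))).mul_left C) ?_
  filter_upwards [(Set.finite_singleton (0 : Fin 2 → ℤ)).compl_mem_cofinite] with m hm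
  have hm0 : 0 < ‖m‖ := norm_pos_iff.2 hm
  rw [norm_norm]
  have e : ‖m‖ ^ (-4 : ℝ) = (‖m‖ ^ 2)⁻¹ ^ 2 := by
    rw [Real.rpow_neg hm0.le, inv_pow, ← pow_mul]
    norm_cast
  rw [e]
  have h1 : ‖m‖ ^ 2 * ‖latticeCoeff a u m‖ ≤ C * (‖latticeCoeff a (D2 0 0) m‖ +
      ‖latticeCoeff a (D2 1 1) m‖) := by
    refine (mul_le_mul_of_nonneg_right (hfreq m) (norm_nonneg _)).trans ?_
    rw [mul_assoc, Fin.sum_univ_two, add_mul]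
    exact mul_le_mul_of_nonneg_left (add_le_add (hcoeff 0 m) (hcoeff 1 m)) hC.le
  have hp : 0 < (‖m‖ ^ 2)⁻¹ := by positivity
  have h2 : ‖latticeCoeff a u m‖ ≤ C * ((‖m‖ ^ 2)⁻¹ * (‖latticeCoeff a (D2 0 0) m‖ +
      ‖latticeCoeff a (D2 1 1) m‖)) := by
    calc _ = (‖m‖ ^ 2)⁻¹ * (‖m‖ ^ 2 * ‖latticeCoeff a u m‖) := by field_simp
      _ ≤ _ := (mul_le_mul_of_nonneg_left h1 hp.le).trans_eq (by ring)
  refine h2.trans (mul_le_mul_of_nonneg_left ?_ hC.le)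
  nlinarith [sq_nonneg ((‖m‖ ^ 2)⁻¹ - (‖latticeCoeff a (D2 0 0) m‖ +
      ‖latticeCoeff a (D2 1 1) m‖)), sq_nonneg (‖latticeCoeff a (D2 0 0) m‖ -
      ‖latticeCoeff a (D2 1 1) m‖)]

/-- The disagreement set is invariant under the countable lattice and null in a fundamental domain.
-/
theorem ae_eq_of_ae_eq_unitCell {u v : Plane → ℂ} (hu : LatticePeriodic a u)
    (hv : LatticePeriodic a v) (h : v =ᵐ[volume.restrict (unitCell a)] u) : v =ᵐ[volume] u := by
  have : Countable (Submodule.span ℤ (Set.range a)).toAddSubgroup :=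
    inferInstanceAs (Countable (Submodule.span ℤ (Set.range a)))
  have hfd := ZSpan.isAddFundamentalDomain' a (volume : Measure Plane)
  refine hfd.measure_zero_of_invariant _ ?_ ?_
  · intro g
    ext x
    rw [Set.mem_vadd_set_iff_neg_vadd_mem]
    have e : (-g +ᵥ x : Plane) = x + ((-g : (Submodule.span ℤ (Set.range a)).toAddSubgroup) : Plane) := by
      rw [AddSubgroup.vadd_def, vadd_eq_add, add_comm]
    simp only [Set.mem_compl_iff, Set.mem_ofPred_eq, e, hu _ (-g).2, hv _ (-g).2]
  · rwa [Filter.EventuallyEq, ae_iff, unitCell, Measure.restrict_apply₀'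
      (ZSpan.fundamentalDomain_measurableSet a).nullMeasurableSet] at h

/-- Sobolev embedding `W^{2,2} ⊆ C⁰` on the two-dimensional torus. -/
theorem exists_continuous_representative {u : Plane → ℂ} {D : Fin 2 → Plane → ℂ}
    {D2 : Fin 2 → Fin 2 → Plane → ℂ} (hu : HasSobolevDerivs a u D D2) :
    ∃ v : Plane → ℂ, (Continuous v ∧ LatticePeriodic a v ∧ v =ᵐ[volume] u) ∧
      ∃ C, ∀ x, ‖v x‖ ≤ C := by
  obtain ⟨G, hG⟩ := exists_continuous_ae_eq_of_summable_mFourierCoeff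
    (memLp_comp_torusParam a hu.mem) (summable_latticeCoeff a hu)
  obtain ⟨c, hc0, hc⟩ := exists_measurePreserving_torusParam a
  have hper : LatticePeriodic a (G ∘ torusProj a) := fun γ hγ x =>
    congrArg G (torusProj_periodic a γ hγ x)
  refine ⟨G ∘ torusProj a, ⟨G.continuous.comp (continuous_torusProj a), hper, ?_⟩,
    ‖G‖, fun x => G.norm_coe_le_norm _⟩
  refine ae_eq_of_ae_eq_unitCell a hu.mem.1 hper ?_
  have h1 : ∀ᵐ y ∂(c • volume.restrict (unitCell a)), (G ∘ torusProj a) y = u y := by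
    rw [← hc.map_eq, (measurableEmbedding_torusParam a).ae_map_iff]
    filter_upwards [hG] with t ht
    rw [Function.comp, torusProj_torusParam, ht, Function.comp]
  exact (Measure.ae_smul_measure_iff hc0).1 h1

end BlochSobolev
end

/-! ### Decay of Fourier integrals -/

noncomputable section
namespace OscillatoryDecay

/-- The Fourier integral `∫ exp (i q · x) f(q) dq`. -/
def osc (f : Plane → ℂ) (x : Plane) : ℂ :=
  ∫ q, Complex.exp (Complex.I * (⟪q, x⟫ : ℝ)) * f q

theorem osc_eq_fourier (f : Plane → ℂ) (x : Plane) :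
    osc f x = FourierTransform.fourier f (-(2 * Real.pi)⁻¹ • x) := by
  rw [Real.fourier_eq', osc]
  congr 1
  funext q
  rw [inner_smul_right, smul_eq_mul]
  congr 2
  push_cast
  have : (Real.pi : ℂ) ≠ 0 := by exact_mod_cast Real.pi_ne_zero
  field_simp

theorem norm_exp_I_mul_ofReal (s : ℝ) : ‖Complex.exp (Complex.I * s)‖ = 1 := by
  rw [mul_comm]; exact Complex.norm_exp_ofReal_mul_I s

theorem norm_osc_le (f : Plane → ℂ) (x : Plane) : ‖osc f x‖ ≤ ∫ q, ‖f q‖ := by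
  refine (norm_integral_le_integral_norm _).trans_eq ?_
  simp

theorem integrable_exp_mul {f : Plane → ℂ} (hf : Integrable f) (x : Plane) :
    Integrable fun q => Complex.exp (Complex.I * (⟪q, x⟫ : ℝ)) * f q := by
  refine hf.bdd_mul (c := 1) (Continuous.aestronglyMeasurable (by fun_prop)) ?_
  exact .of_forall fun q => (norm_exp_I_mul_ofReal _).le

theorem osc_add {f g : Plane → ℂ} (hf : Integrable f) (hg : Integrable g) (x : Plane) :
    osc (fun q => f q + g q) x = osc f x + osc g x := by
  simp only [osc, mul_add]
  exact integral_add (integrable_exp_mul hf x) (integrable_exp_mul hg x)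

theorem osc_const_mul (c : ℂ) (f : Plane → ℂ) (x : Plane) :
    osc (fun q => c * f q) x = c * osc f x := by
  simp only [osc, mul_left_comm _ c]
  exact integral_const_mul _ _

theorem osc_comp_two_smul (f : Plane → ℂ) (x : Plane) :
    osc (fun q => f ((2 : ℝ) • q)) x = (1 / 4) * osc f ((1 / 2 : ℝ) • x) := by
  have h := Measure.integral_comp_smul (volume : Measure Plane)
    (fun q => Complex.exp (Complex.I * (⟪q, (1 / 2 : ℝ) • x⟫ : ℝ)) * f q) 2
  have e : ∀ q : Plane, ⟪(2 : ℝ) • q, (1 / 2 : ℝ) • x⟫ = ⟪q, x⟫ := by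
    intro q
    rw [inner_smul_left, inner_smul_right]
    simp
  simp only [e] at h
  rw [osc, h, osc]
  simp
  norm_num

/-- The Fourier integral of a compactly supported `Cⁿ` function decays like `|x|⁻ⁿ`. -/
theorem exists_pow_mul_norm_osc_le {f : Plane → ℂ} {n : ℕ} (hf : ContDiff ℝ n f)
    (hc : HasCompactSupport f) : ∃ C, 0 ≤ C ∧ ∀ x, ‖x‖ ^ n * ‖osc f x‖ ≤ C := by
  have hint : ∀ k m : ℕ, (k : ℕ∞) ≤ 0 → (m : ℕ∞) ≤ n →
      Integrable (fun v => ‖v‖ ^ k * ‖iteratedFDeriv ℝ m f v‖) volume := by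
    intro k m _ hm
    refine Continuous.integrable_of_hasCompactSupport ?_ ?_
    · exact (continuous_norm.pow k).mul
        (hf.continuous_iteratedFDeriv (by exact_mod_cast hm)).norm
    · exact ((hc.iteratedFDeriv m).norm).mul_left
  have key := fun w => Real.pow_mul_norm_iteratedFDeriv_fourier_le (K := 0) (N := n)
    (by exact_mod_cast hf) hint (k := 0) (n := n) le_rfl le_rfl w
  simp only [norm_iteratedFDeriv_zero] at key
  set K := (2 * Real.pi) ^ 0 * (2 * ((0 : ℕ) : ℝ) + 2) ^ n *
    ∑ p ∈ Finset.range (0 + 1) ×ˢ Finset.range (n + 1),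
      ∫ v, ‖v‖ ^ p.1 * ‖iteratedFDeriv ℝ p.2 f v‖ with hK
  have hK0 : 0 ≤ K := le_trans (by positivity) (key 0)
  -- The factor (2π)ⁿ undoes the rescaling of x in `osc_eq_fourier`.
  refine ⟨(2 * Real.pi) ^ n * K, by positivity, fun x => ?_⟩
  have h := key (-(2 * Real.pi)⁻¹ • x)
  rw [← osc_eq_fourier, norm_smul, mul_pow, norm_neg, norm_inv, Real.norm_of_nonneg
    (by positivity : (0 : ℝ) ≤ 2 * Real.pi), inv_pow, mul_assoc] at h
  have hp : 0 < (2 * Real.pi) ^ n := by positivity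
  rwa [inv_mul_le_iff₀ hp] at h

/-! ### Homogeneous functions with a cutoff -/

variable {g : Plane → ℂ} {p : ℕ}

theorem aestronglyMeasurable_of_continuousAt_ne_zero {f : Plane → ℂ}
    (hf : ∀ q ≠ 0, ContinuousAt f q) : AEStronglyMeasurable f volume := by
  have h : ContinuousOn f ({0}ᶜ : Set Plane) := fun q hq => (hf q hq).continuousWithinAt
  have := h.aestronglyMeasurable (μ := volume) (measurableSet_singleton (0 : Plane)).compl
  rwa [Measure.restrict_eq_self_of_ae_mem] at this
  exact compl_mem_ae_iff.2 (measure_singleton _)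

theorem integrable_of_norm_le_of_support {f : Plane → ℂ}
    (hf : ∀ q ≠ 0, ContinuousAt f q) {M R : ℝ} (hM : ∀ q, ‖f q‖ ≤ M)
    (hR : ∀ q, R ≤ ‖q‖ → f q = 0) : Integrable f := by
  have hs : Function.support f ⊆ Metric.ball (0 : Plane) R := by
    intro q hq
    by_contra h
    exact hq (hR q (by simpa using h))
  rw [← integrableOn_iff_integrable_of_support_subset hs]
  exact Measure.integrableOn_of_bounded (M := M) measure_ball_lt_top.ne
    (aestronglyMeasurable_of_continuousAt_ne_zero hf) (.of_forall hM)

theorem integrable_homogeneous_mul (hg : ∀ q ≠ 0, ContDiffAt ℝ ∞ g q) {M : ℝ}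
    (hM : ∀ q, ‖g q‖ ≤ M * ‖q‖ ^ p) {η : Plane → ℝ} (hη : ∀ q ≠ 0, ContinuousAt η q)
    {R B : ℝ} (hB : ∀ q, |η q| ≤ B) (hR : ∀ q, R ≤ ‖q‖ → η q = 0) :
    Integrable fun q => g q * (η q : ℂ) := by
  have hM0 : 0 ≤ |M| := abs_nonneg M
  refine integrable_of_norm_le_of_support (M := |M| * |R| ^ p * |B|) (R := R) ?_ ?_ ?_
  · exact fun q hq => (hg q hq).continuousAt.mul
      (Complex.continuous_ofReal.continuousAt.comp (hη q hq))
  · intro q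
    rcases le_or_gt R ‖q‖ with h | h
    · rw [hR q h]; simp; positivity
    · rw [norm_mul, Complex.norm_real, Real.norm_eq_abs]
      refine mul_le_mul ((hM q).trans ?_) ((hB q).trans (le_abs_self B)) (abs_nonneg _)
        (by positivity)
      gcongr
      · exact le_abs_self M
      · exact h.le.trans (le_abs_self R)
  · intro q hq
    rw [hR q hq]; simp

/-- The product of a function smooth off the origin with a compactly supported cutoff that vanishes
near the origin. -/
theorem contDiff_mul_of_eventually_zero {m : ℕ} (hg : ∀ q ≠ 0, ContDiffAt ℝ ∞ g q)
    {η : Plane → ℝ} (hη : ∀ q ≠ 0, ContDiffAt ℝ m η q) (h0 : ∀ᶠ q in nhds 0, η q = 0) :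
    ContDiff ℝ m fun q => g q * (η q : ℂ) := by
  rw [contDiff_iff_contDiffAt]
  intro q
  rcases eq_or_ne q 0 with rfl | hq
  · refine (contDiffAt_const (c := (0 : ℂ))).congr_of_eventuallyEq ?_
    filter_upwards [h0] with q hq
    simp [hq]
  · exact ((hg q hq).of_le (by exact_mod_cast le_top)).mul
      (Complex.ofRealCLM.contDiff.contDiffAt.comp q (hη q hq))

theorem hasCompactSupport_mul_of_norm_ge {η : Plane → ℝ} {R : ℝ}
    (hR : ∀ q, R ≤ ‖q‖ → η q = 0) : HasCompactSupport fun q => g q * (η q : ℂ) := by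
  refine HasCompactSupport.intro (isCompact_closedBall (0 : Plane) R) fun q hq => ?_
  have : R ≤ ‖q‖ := by
    simp only [Metric.mem_closedBall, dist_zero_right, not_le] at hq
    exact hq.le
  simp [hR q this]

/-- The Fourier integral of a homogeneous function of degree `p`, smooth away from the origin and
cut off smoothly at infinity, decays like `|x|⁻⁽ᵖ⁺²⁾`. -/
theorem exists_pow_mul_norm_osc_bump_le (hg : ∀ q ≠ 0, ContDiffAt ℝ ∞ g q) {M : ℝ}
    (hM : ∀ q, ‖g q‖ ≤ M * ‖q‖ ^ p) (hhom : ∀ q, g ((2 : ℝ) • q) = 2 ^ p * g q)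
    (η : ContDiffBump (0 : Plane)) :
    ∃ C, ∀ x, ‖x‖ ^ (p + 2) * ‖osc (fun q => g q * (η q : ℂ)) x‖ ≤ C := by
  set A := osc (fun q => g q * (η q : ℂ)) with hA
  set δ : Plane → ℝ := fun q => η q - η ((2 : ℝ) • q) with hδ
  have hηR : ∀ q : Plane, η.rOut ≤ ‖q‖ → η q = 0 := fun q hq =>
    η.zero_of_le_dist (by simpa using hq)
  have hη2R : ∀ q : Plane, η.rOut ≤ ‖q‖ → η ((2 : ℝ) • q) = 0 := fun q hq =>
    hηR _ (by rw [norm_smul]; norm_num; linarith [norm_nonneg q])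
  have hδR : ∀ q : Plane, η.rOut ≤ ‖q‖ → δ q = 0 := fun q hq => by
    simp only [hδ, hηR q hq, hη2R q hq, sub_zero]
  have hδs : ContDiff ℝ ∞ δ := η.contDiff.sub (η.contDiff.comp (contDiff_const_smul (2 : ℝ)))
  have hη1 : ∀ᶠ q in nhds (0 : Plane), η q = 1 := η.eventuallyEq_one
  have hη21 : ∀ᶠ q in nhds (0 : Plane), η ((2 : ℝ) • q) = 1 := by
    have ht : Filter.Tendsto (fun q : Plane => (2 : ℝ) • q) (nhds 0) (nhds 0) := by
      have := (continuous_const_smul (2 : ℝ)).tendsto (0 : Plane)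
      rwa [smul_zero] at this
    exact ht.eventually hη1
  have hδ0 : ∀ᶠ q in nhds 0, δ q = 0 := by
    filter_upwards [hη1, hη21] with q h1 h2
    simp only [hδ, h1, h2, sub_self]
  -- One order more than the target rate: the surplus 1/|x| makes the errors of the dyadic iteration
  -- summable.
  obtain ⟨C, hC0, hC⟩ := exists_pow_mul_norm_osc_le (n := p + 3)
    (contDiff_mul_of_eventually_zero hg
      (fun q _ => (contDiff_infty.1 hδs _).contDiffAt) hδ0)
    (hasCompactSupport_mul_of_norm_ge (g := g) hδR)
  have hηB : ∀ q, |η q| ≤ 1 := fun q => by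
    rw [abs_of_nonneg η.nonneg]; exact η.le_one
  have hi2 : Integrable fun q => g q * ((η ((2 : ℝ) • q) : ℝ) : ℂ) :=
    integrable_homogeneous_mul hg hM
      (η := fun q => η ((2 : ℝ) • q))
      (fun q _ => (η.continuous.comp (continuous_const_smul (2 : ℝ))).continuousAt)
      (fun q => hηB _) hη2R
  have hi3 : Integrable fun q => g q * (δ q : ℂ) :=
    integrable_homogeneous_mul hg hM (B := 2) (fun q _ => hδs.continuous.continuousAt)
      (fun q => (abs_sub _ _).trans (by linarith [hηB q, hηB ((2 : ℝ) • q)])) hδR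
  -- The factor 2^{-(p+2)} combines 2^{-p} from homogeneity with 1/4 from the Jacobian.
  have hrec : ∀ x, A x = osc (fun q => g q * (δ q : ℂ)) x +
      ((2 : ℂ) ^ (p + 2))⁻¹ * A ((1 / 2 : ℝ) • x) := by
    intro x
    have e1 : (fun q => g q * (η q : ℂ)) =
        fun q => g q * (δ q : ℂ) + g q * ((η ((2 : ℝ) • q) : ℝ) : ℂ) := by
      funext q; simp only [hδ]; push_cast; ring
    have e2 : (fun q => g q * ((η ((2 : ℝ) • q) : ℝ) : ℂ)) =
        fun q => ((2 : ℂ) ^ p)⁻¹ * (fun q => g q * (η q : ℂ)) ((2 : ℝ) • q) := by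
      funext q
      simp only [hhom]
      field_simp
    have e3 : osc (fun q => g q * ((η ((2 : ℝ) • q) : ℝ) : ℂ)) x =
        ((2 : ℂ) ^ (p + 2))⁻¹ * A ((1 / 2 : ℝ) • x) := by
      rw [e2, osc_const_mul, osc_comp_two_smul (fun q => g q * (η q : ℂ)), pow_add]
      field_simp
      rw [mul_comm, hA]
      norm_num
    rw [← e3, hA, ← osc_add hi3 hi2, ← e1]
  set M0 := ∫ q, ‖g q * (η q : ℂ)‖
  have hM0 : 0 ≤ M0 := integral_nonneg fun q => norm_nonneg _
  have hsmall : ∀ x, ‖x‖ ≤ 1 → ‖x‖ ^ (p + 2) * ‖A x‖ ≤ M0 := fun x hx =>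
    (mul_le_of_le_one_left (norm_nonneg _) (pow_le_one₀ (norm_nonneg _) hx)).trans
      (norm_osc_le _ x)
  have hstep : ∀ x, 0 < ‖x‖ → ‖x‖ ^ (p + 2) * ‖A x‖ ≤
      C / ‖x‖ + ‖(1 / 2 : ℝ) • x‖ ^ (p + 2) * ‖A ((1 / 2 : ℝ) • x)‖ := by
    intro x hx
    have h1 : ‖x‖ ^ (p + 2) * ‖osc (fun q => g q * (δ q : ℂ)) x‖ ≤ C / ‖x‖ := by
      rw [le_div_iff₀ hx]
      exact le_trans (le_of_eq (by ring)) (hC x)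
    have h2 : ‖(1 / 2 : ℝ) • x‖ ^ (p + 2) * ‖A ((1 / 2 : ℝ) • x)‖ =
        ‖x‖ ^ (p + 2) * ‖((2 : ℂ) ^ (p + 2))⁻¹ * A ((1 / 2 : ℝ) • x)‖ := by
      rw [norm_smul, mul_pow, norm_mul, norm_inv, norm_pow]
      norm_num
      simp only [one_div, inv_pow]
      ring
    rw [h2, hrec x]
    calc _ ≤ ‖x‖ ^ (p + 2) * (‖osc (fun q => g q * (δ q : ℂ)) x‖ +
          ‖((2 : ℂ) ^ (p + 2))⁻¹ * A ((1 / 2 : ℝ) • x)‖) := by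
            gcongr; exact norm_add_le _ _
      _ ≤ _ := by rw [mul_add]; gcongr
  -- Subtracting C/|x| closes the induction exactly: halving x doubles this term, and `hstep` gives
  -- one copy back. The lower bound 1/2 survives because x is halved only when |x| > 1.
  have hbig : ∀ N : ℕ, ∀ x, 1 / 2 ≤ ‖x‖ → ‖x‖ ≤ 2 ^ N →
      ‖x‖ ^ (p + 2) * ‖A x‖ ≤ M0 + 2 * C - C / ‖x‖ := by
    have hbase : ∀ x, 1 / 2 ≤ ‖x‖ → ‖x‖ ≤ 1 →
        ‖x‖ ^ (p + 2) * ‖A x‖ ≤ M0 + 2 * C - C / ‖x‖ := by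
      intro x h1 h2
      have : C / ‖x‖ ≤ 2 * C := by
        rw [div_le_iff₀ (by linarith)]; nlinarith
      linarith [hsmall x h2]
    intro N
    induction N with
    | zero => intro x h1 h2; exact hbase x h1 (by simpa using h2)
    | succ N ih =>
      intro x h1 h2
      rcases le_or_gt ‖x‖ 1 with h3 | h3
      · exact hbase x h1 h3
      have hn : ‖(1 / 2 : ℝ) • x‖ = ‖x‖ / 2 := by
        rw [norm_smul]; norm_num; ring
      have := ih ((1 / 2 : ℝ) • x) (by rw [hn]; linarith) (by rw [hn]; rw [pow_succ] at h2; linarith)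
      have e : C / ‖(1 / 2 : ℝ) • x‖ = 2 * (C / ‖x‖) := by
        rw [hn]; field_simp
      rw [e] at this
      linarith [hstep x (by linarith)]
  refine ⟨M0 + 2 * C, fun x => ?_⟩
  rcases le_or_gt ‖x‖ 1 with h | h
  · linarith [hsmall x h]
  · obtain ⟨N, hN⟩ := pow_unbounded_of_one_lt ‖x‖ (by norm_num : (1 : ℝ) < 2)
    have h0 : 0 ≤ C / ‖x‖ := by positivity
    linarith [hbig N x (by linarith) hN.le]

theorem contDiffAt_comp_norm {χ : ℝ → ℝ} {m : WithTop ℕ∞} (hχ : ContDiffOn ℝ m χ (Set.Ici 0))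
    {q : Plane} (hq : q ≠ 0) : ContDiffAt ℝ m (fun q => χ ‖q‖) q :=
  ((hχ.contDiffAt (Ici_mem_nhds (norm_pos_iff.2 hq))).comp q (contDiffAt_norm ℝ hq))

theorem exists_abs_le_of_cutoff {χ : ℝ → ℝ} {r : ℝ} (hχ : ContinuousOn χ (Set.Ici 0))
    (hχ_zero : ∀ t, r ≤ t → χ t = 0) : ∃ B, ∀ q : Plane, |χ ‖q‖| ≤ B := by
  obtain ⟨B, hB⟩ := isCompact_Icc.exists_bound_of_continuousOn
    (hχ.mono (Set.Icc_subset_Ici_self : Set.Icc 0 |r| ⊆ Set.Ici 0))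
  refine ⟨max B 0, fun q => ?_⟩
  rcases le_or_gt ‖q‖ |r| with h | h
  · exact (hB _ ⟨norm_nonneg q, h⟩).trans (le_max_left _ _)
  · rw [hχ_zero _ ((le_abs_self r).trans h.le)]; simp

theorem integrable_homogeneous_mul_cutoff (hg : ∀ q ≠ 0, ContDiffAt ℝ ∞ g q) {M : ℝ}
    (hM : ∀ q, ‖g q‖ ≤ M * ‖q‖ ^ p) {χ : ℝ → ℝ} {r : ℝ} (hχ : ContinuousOn χ (Set.Ici 0))
    (hχ_zero : ∀ t, r ≤ t → χ t = 0) : Integrable fun q => g q * (χ ‖q‖ : ℂ) := by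
  obtain ⟨B, hB⟩ := exists_abs_le_of_cutoff hχ hχ_zero
  exact integrable_homogeneous_mul hg hM (η := fun q => χ ‖q‖)
    (fun q hq => (contDiffAt_comp_norm (contDiffOn_zero.2 hχ) hq).continuousAt) hB
    fun q hq => hχ_zero _ hq

/-- The Fourier integral of a homogeneous function of degree `p`, smooth away from the origin,
times a radial `Cᵖ⁺²` cutoff, decays like `|x|⁻⁽ᵖ⁺²⁾`. -/
theorem exists_pow_mul_norm_osc_cutoff_le (hg : ∀ q ≠ 0, ContDiffAt ℝ ∞ g q) {M : ℝ}
    (hM : ∀ q, ‖g q‖ ≤ M * ‖q‖ ^ p) (hhom : ∀ q, g ((2 : ℝ) • q) = 2 ^ p * g q)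
    {χ : ℝ → ℝ} {ρ r : ℝ} (hρ : 0 < ρ) (hρr : ρ < r)
    (hχ : ContDiffOn ℝ ((p + 2 : ℕ) : WithTop ℕ∞) χ (Set.Ici 0))
    (hχ_one : ∀ t, 0 ≤ t → t ≤ ρ → χ t = 1) (hχ_zero : ∀ t, r ≤ t → χ t = 0) :
    ∃ C, ∀ x, ‖x‖ ^ (p + 2) * ‖osc (fun q => g q * (χ ‖q‖ : ℂ)) x‖ ≤ C := by
  -- Near 0 both cutoffs equal 1, and both vanish beyond r, so their difference is supported away
  -- from the singularity of g.
  let η : ContDiffBump (0 : Plane) := ⟨ρ / 2, ρ, by linarith, by linarith⟩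
  obtain ⟨C₁, hC₁⟩ := exists_pow_mul_norm_osc_bump_le hg hM hhom η
  have hηR : ∀ q : Plane, r ≤ ‖q‖ → η q = 0 := fun q hq =>
    η.zero_of_le_dist (by rw [dist_zero_right]; exact hρr.le.trans hq)
  set δ : Plane → ℝ := fun q => χ ‖q‖ - η q with hδ
  have hδR : ∀ q : Plane, r ≤ ‖q‖ → δ q = 0 := fun q hq => by
    simp only [hδ, hηR q hq, hχ_zero _ hq, sub_zero]
  have hδs : ∀ q ≠ 0, ContDiffAt ℝ ((p + 2 : ℕ) : WithTop ℕ∞) δ q := fun q hq =>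
    (contDiffAt_comp_norm hχ hq).sub η.contDiffAt
  have hδ0 : ∀ᶠ q in nhds 0, δ q = 0 := by
    filter_upwards [η.eventuallyEq_one, Metric.ball_mem_nhds (0 : Plane) hρ] with q h1 h2
    have : ‖q‖ < ρ := by simpa using h2
    simp only [hδ, h1, hχ_one _ (norm_nonneg q) this.le, Pi.one_apply, sub_self]
  have hδc := contDiff_mul_of_eventually_zero hg hδs hδ0
  have hδcs := hasCompactSupport_mul_of_norm_ge (g := g) hδR
  obtain ⟨C₂, -, hC₂⟩ := exists_pow_mul_norm_osc_le hδc hδcs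
  have hi1 : Integrable fun q => g q * (η q : ℂ) :=
    integrable_homogeneous_mul hg hM (fun q _ => η.continuous.continuousAt)
      (fun q => by rw [abs_of_nonneg η.nonneg]; exact η.le_one) hηR
  have hi2 := hδc.continuous.integrable_of_hasCompactSupport (μ := volume) hδcs
  refine ⟨C₁ + C₂, fun x => ?_⟩
  have e : (fun q => g q * (χ ‖q‖ : ℂ)) =
      fun q => g q * (η q : ℂ) + g q * (δ q : ℂ) := by
    funext q; simp only [hδ]; push_cast; ring
  rw [e, osc_add hi1 hi2]
  calc _ ≤ ‖x‖ ^ (p + 2) * (‖osc (fun q => g q * (η q : ℂ)) x‖ +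
        ‖osc (fun q => g q * (δ q : ℂ)) x‖) := by gcongr; exact norm_add_le _ _
    _ ≤ _ := by rw [mul_add]; exact add_le_add (hC₁ x) (hC₂ x)

end OscillatoryDecay
end

/-! ### The canonical eigenvector and its Wannier functions -/

noncomputable section
namespace CanonicalWannier
open OscillatoryDecay

/-- The identification of the plane with the complex numbers. -/
def toComplex (q : Plane) : ℂ := (q 0 : ℂ) + (q 1 : ℂ) * Complex.I

theorem contDiff_toComplex : ContDiff ℝ ∞ toComplex := by
  have h : ∀ i : Fin 2, ContDiff ℝ ∞ fun q : Plane => ((q i : ℝ) : ℂ) := fun i =>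
    Complex.ofRealCLM.contDiff.comp (EuclideanSpace.proj (𝕜 := ℝ) i).contDiff
  exact (h 0).add ((h 1).mul contDiff_const)

theorem toComplex_ne_zero {q : Plane} (hq : q ≠ 0) : toComplex q ≠ 0 := by
  contrapose! hq
  have h0 := congrArg Complex.re hq
  have h1 := congrArg Complex.im hq
  simp [toComplex] at h0 h1
  ext i
  fin_cases i <;> simpa

/-- The phase `exp (i θ_q)`. -/
def phase (q : Plane) : ℂ := Complex.exp (polarAngle q * Complex.I)

theorem phase_ne_zero (q : Plane) : phase q ≠ 0 := Complex.exp_ne_zero _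

theorem norm_phase (q : Plane) : ‖phase q‖ = 1 := Complex.norm_exp_ofReal_mul_I _

theorem phase_eq {q : Plane} (hq : q ≠ 0) :
    phase q = ((‖toComplex q‖ : ℝ) : ℂ)⁻¹ * toComplex q := by
  have h : ((‖toComplex q‖ : ℝ) : ℂ) * phase q = toComplex q :=
    Complex.norm_mul_exp_arg_mul_I (toComplex q)
  have h0 : ((‖toComplex q‖ : ℝ) : ℂ) ≠ 0 := by
    exact_mod_cast norm_ne_zero_iff.2 (toComplex_ne_zero hq)
  field_simp
  rw [mul_comm, h]

/-- The polar angle jumps across a ray, but its exponential is z/|z|, which does not see the branch.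
-/
theorem contDiffAt_phase {q : Plane} (hq : q ≠ 0) : ContDiffAt ℝ ∞ phase q := by
  have h0 : ((‖toComplex q‖ : ℝ) : ℂ) ≠ 0 := by
    exact_mod_cast norm_ne_zero_iff.2 (toComplex_ne_zero hq)
  have h1 : ContDiffAt ℝ ∞ (fun q => ((‖toComplex q‖ : ℝ) : ℂ)) q :=
    Complex.ofRealCLM.contDiff.contDiffAt.comp q
      (contDiff_toComplex.contDiffAt.norm ℝ (toComplex_ne_zero hq))
  refine ((h1.inv h0).mul contDiff_toComplex.contDiffAt).congr_of_eventuallyEq ?_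
  filter_upwards [isOpen_ne.mem_nhds hq] with q' hq'
  exact phase_eq hq'

theorem contDiffAt_phase_zpow (n : ℤ) {q : Plane} (hq : q ≠ 0) :
    ContDiffAt ℝ ∞ (fun q => phase q ^ n) q := by
  cases n with
  | ofNat k => simpa using (contDiffAt_phase hq).pow k
  | negSucc k =>
    simp only [zpow_negSucc]
    exact ((contDiffAt_phase hq).pow (k + 1)).inv (pow_ne_zero _ (phase_ne_zero q))

theorem polarAngle_smul {t : ℝ} (ht : 0 < t) (q : Plane) :
    polarAngle (t • q) = polarAngle q := by
  have : ((t • q) 0 : ℂ) + ((t • q) 1 : ℂ) * Complex.I =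
      (t : ℂ) * ((q 0 : ℂ) + (q 1 : ℂ) * Complex.I) := by
    simp; ring
  rw [polarAngle, this, Complex.arg_real_mul _ ht, polarAngle]

theorem phase_zpow (n : ℤ) (q : Plane) :
    phase q ^ n = Complex.exp (Complex.I * n * polarAngle q / 2) ^ 2 := by
  rw [phase, ← Complex.exp_int_mul, ← Complex.exp_nat_mul]
  congr 1
  push_cast
  ring

/-- The prefactor e^{inθ/2} absorbs the half angles of the cosine, leaving only the single-valued
e^{inθ}. -/
theorem canonicalEigenvector_zero (n : ℤ) (q : Plane) :
    canonicalEigenvector n q 0 = (phase q ^ n + 1) / 2 := by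
  rw [phase_zpow]
  simp only [canonicalEigenvector, Matrix.cons_val_zero, Complex.cos]
  have e1 : (n : ℂ) * polarAngle q / 2 * Complex.I = Complex.I * n * polarAngle q / 2 := by ring
  have e2 : -((n : ℂ) * polarAngle q / 2) * Complex.I =
      -(Complex.I * n * polarAngle q / 2) := by ring
  rw [e1, e2, Complex.exp_neg]
  have := Complex.exp_ne_zero (Complex.I * n * polarAngle q / 2)
  field_simp

theorem canonicalEigenvector_one (n : ℤ) (q : Plane) :
    canonicalEigenvector n q 1 = (1 - phase q ^ n) * Complex.I / 2 := by
  rw [phase_zpow]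
  simp only [canonicalEigenvector, Matrix.cons_val_one, Complex.sin]
  have e1 : (n : ℂ) * polarAngle q / 2 * Complex.I = Complex.I * n * polarAngle q / 2 := by ring
  have e2 : -((n : ℂ) * polarAngle q / 2) * Complex.I =
      -(Complex.I * n * polarAngle q / 2) := by ring
  rw [e1, e2, Complex.exp_neg]
  have := Complex.exp_ne_zero (Complex.I * n * polarAngle q / 2)
  simp
  field_simp

theorem contDiffAt_canonicalEigenvector (n : ℤ) (i : Fin 2) {q : Plane} (hq : q ≠ 0) :
    ContDiffAt ℝ ∞ (fun q => canonicalEigenvector n q i) q := by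
  fin_cases i
  · simp only [Fin.zero_eta, canonicalEigenvector_zero]
    exact ((contDiffAt_phase_zpow n hq).add contDiffAt_const).div_const _
  · simp only [Fin.mk_one, canonicalEigenvector_one]
    exact ((contDiffAt_const.sub (contDiffAt_phase_zpow n hq)).mul contDiffAt_const).div_const _

theorem norm_canonicalEigenvector_le (n : ℤ) (i : Fin 2) (q : Plane) :
    ‖canonicalEigenvector n q i‖ ≤ 1 := by
  have h : ‖phase q ^ n‖ = 1 := by rw [norm_zpow, norm_phase, one_zpow]
  fin_cases i
  · simp only [Fin.zero_eta, canonicalEigenvector_zero]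
    rw [norm_div]
    have := norm_add_le (phase q ^ n) 1
    rw [h, norm_one] at this
    norm_num; linarith
  · simp only [Fin.mk_one, canonicalEigenvector_one]
    rw [norm_div, norm_mul]
    have := norm_sub_le 1 (phase q ^ n)
    rw [h, norm_one] at this
    norm_num; linarith

theorem canonicalEigenvector_smul (n : ℤ) {t : ℝ} (ht : 0 < t) (q : Plane) :
    canonicalEigenvector n (t • q) = canonicalEigenvector n q := by
  simp only [canonicalEigenvector, polarAngle_smul ht]

/-- The weighted component `qⱼᵖ φ_{n,+}(q)ᵢ`, homogeneous of degree `p`. -/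
def weightedComponent (n : ℤ) (j : Fin 2) (p : ℕ) (i : Fin 2) (q : Plane) : ℂ :=
  (q j : ℂ) ^ p * canonicalEigenvector n q i

theorem contDiffAt_weightedComponent (n : ℤ) (j : Fin 2) (p : ℕ) (i : Fin 2) :
    ∀ q ≠ 0, ContDiffAt ℝ ∞ (weightedComponent n j p i) q := by
  intro q hq
  have h : ContDiff ℝ ∞ fun q : Plane => ((q j : ℝ) : ℂ) :=
    Complex.ofRealCLM.contDiff.comp (EuclideanSpace.proj (𝕜 := ℝ) j).contDiff
  exact (h.pow p).contDiffAt.mul (contDiffAt_canonicalEigenvector n i hq)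

theorem norm_weightedComponent_le (n : ℤ) (j : Fin 2) (p : ℕ) (i : Fin 2) (q : Plane) :
    ‖weightedComponent n j p i q‖ ≤ 1 * ‖q‖ ^ p := by
  rw [weightedComponent, norm_mul, norm_pow, Complex.norm_real, mul_comm]
  exact mul_le_mul (norm_canonicalEigenvector_le n i q)
    (pow_le_pow_left₀ (norm_nonneg _) (PiLp.norm_apply_le q j) p) (by positivity) zero_le_one

theorem weightedComponent_two_smul (n : ℤ) (j : Fin 2) (p : ℕ) (i : Fin 2) (q : Plane) :
    weightedComponent n j p i ((2 : ℝ) • q) = 2 ^ p * weightedComponent n j p i q := by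
  simp only [weightedComponent, canonicalEigenvector_smul n two_pos]
  simp [mul_pow, mul_assoc]

/-! ### Wannier functions as Fourier integrals times bounded functions -/

variable {a : Module.Basis (Fin 2) ℝ Plane} {k₀ : Plane} {χ : ℝ → ℝ} {ρ r : ℝ} {n : ℤ}
  {vP vM : Plane → ℂ}

theorem weightedWannier_eq (hχ : ContinuousOn χ (Set.Ici 0)) (hχ_zero : ∀ t, r ≤ t → χ t = 0)
    (j : Fin 2) (p : ℕ) (x : Plane) :
    weightedWannier a k₀ r χ n j p vP vM x =
      Complex.exp (Complex.I * (⟪k₀, x⟫ : ℝ)) * ((1 / Real.sqrt (brillouinArea a) : ℝ) : ℂ) *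
        (osc (fun q => weightedComponent n j p 0 q * (χ ‖q‖ : ℂ)) x * vP x +
          osc (fun q => weightedComponent n j p 1 q * (χ ‖q‖ : ℂ)) x * vM x) := by
  have hi := fun i => integrable_exp_mul (integrable_homogeneous_mul_cutoff
    (contDiffAt_weightedComponent n j p i) (norm_weightedComponent_le n j p i) hχ hχ_zero) x
  rw [weightedWannier, setIntegral_eq_integral_of_forall_compl_eq_zero]
  · rw [osc, osc, ← integral_mul_const, ← integral_mul_const,
      ← integral_add ((hi 0).mul_const _) ((hi 1).mul_const _)]
    refine congrArg (fun z : ℂ => _ * z) (integral_congr_ae (.of_forall fun q => ?_))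
    simp only [canonicalBloch, weightedComponent]
    ring
  · intro q hq
    have : r ≤ ‖q‖ := by simpa using hq
    simp [hχ_zero _ this]

/-- Substituting k = k₀ + q splits off e^{ik₀·x}. The index j = 0 is a dummy, since the weight qⱼ⁰
is 1. -/
theorem canonicalWannier_eq (hχ_zero : ∀ t, r ≤ t → χ t = 0) (x : Plane) :
    canonicalWannier a k₀ r χ n vP vM x = weightedWannier a k₀ r χ n 0 0 vP vM x := by
  rw [canonicalWannier, weightedWannier, setIntegral_eq_integral_of_forall_compl_eq_zero,
    setIntegral_eq_integral_of_forall_compl_eq_zero,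
    ← integral_add_right_eq_self _ k₀, mul_comm (Complex.exp _), mul_assoc]
  · congr 1
    rw [← integral_const_mul]
    refine integral_congr_ae (.of_forall fun q => ?_)
    simp only [add_sub_cancel_right, inner_add_left, Complex.ofReal_add, mul_add, Complex.exp_add]
    ring
  · intro q hq
    have : r ≤ ‖q‖ := by simpa using hq
    simp [hχ_zero _ this]
  · intro q hq
    have : r ≤ ‖q - k₀‖ := by simpa [dist_eq_norm] using hq
    simp [hχ_zero _ this]

theorem exists_norm_weightedWannier_le {CP CM : ℝ} (hP : ∀ x, ‖vP x‖ ≤ CP)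
    (hM : ∀ x, ‖vM x‖ ≤ CM) (hρ : 0 < ρ) (hρr : ρ < r)
    (hχ_one : ∀ t, 0 ≤ t → t ≤ ρ → χ t = 1) (hχ_zero : ∀ t, r ≤ t → χ t = 0)
    (j : Fin 2) (p : ℕ) (hχ : ContDiffOn ℝ ((p + 2 : ℕ) : WithTop ℕ∞) χ (Set.Ici 0)) :
    ∃ R > 0, ∃ c > 0, ∀ x : Plane, R ≤ ‖x‖ →
      ‖weightedWannier a k₀ r χ n j p vP vM x‖ ≤ c / ‖x‖ ^ (p + 2) := by
  have hdecay := fun i => exists_pow_mul_norm_osc_cutoff_le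
    (contDiffAt_weightedComponent n j p i) (norm_weightedComponent_le n j p i)
    (weightedComponent_two_smul n j p i) hρ hρr hχ hχ_one hχ_zero
  obtain ⟨C₀, h₀⟩ := hdecay 0
  obtain ⟨C₁, h₁⟩ := hdecay 1
  set s := ‖((1 / Real.sqrt (brillouinArea a) : ℝ) : ℂ)‖ with hs
  -- The absolute value and the added 1 only serve to make the constant strictly positive.
  refine ⟨1, one_pos, |s * (C₀ * CP + C₁ * CM)| + 1, by positivity, fun x hx => ?_⟩
  rw [le_div_iff₀ (by positivity), weightedWannier_eq hχ.continuousOn hχ_zero, norm_mul, norm_mul,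
    norm_exp_I_mul_ofReal, one_mul, ← hs]
  set A := osc (fun q => weightedComponent n j p 0 q * (χ ‖q‖ : ℂ)) x
  set B := osc (fun q => weightedComponent n j p 1 q * (χ ‖q‖ : ℂ)) x
  have hA : ‖x‖ ^ (p + 2) * ‖A‖ * ‖vP x‖ ≤ C₀ * CP :=
    mul_le_mul (h₀ x) (hP x) (norm_nonneg _) (le_trans (by positivity) (h₀ x))
  have hB : ‖x‖ ^ (p + 2) * ‖B‖ * ‖vM x‖ ≤ C₁ * CM :=
    mul_le_mul (h₁ x) (hM x) (norm_nonneg _) (le_trans (by positivity) (h₁ x))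
  calc s * ‖A * vP x + B * vM x‖ * ‖x‖ ^ (p + 2)
      ≤ s * (‖A‖ * ‖vP x‖ + ‖B‖ * ‖vM x‖) * ‖x‖ ^ (p + 2) := by
        gcongr
        exact (norm_add_le _ _).trans_eq (by rw [norm_mul, norm_mul])
    _ = s * (‖x‖ ^ (p + 2) * ‖A‖ * ‖vP x‖ + ‖x‖ ^ (p + 2) * ‖B‖ * ‖vM x‖) := by ring
    _ ≤ s * (C₀ * CP + C₁ * CM) := by gcongr
    _ ≤ _ := (le_abs_self _).trans (by linarith)

end CanonicalWannier
end

theorem mainTheorem3 (a : Module.Basis (Fin 2) ℝ Plane)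
    (V : Plane → ℝ) (hV : LatticePeriodic a V) (k₀ : Plane) (E₀ : ℝ) (uP uM : Plane → ℂ)
    (hP : SolvesBlochEigenproblem a V k₀ E₀ uP) (hM : SolvesBlochEigenproblem a V k₀ E₀ uM)
    (ρ r : ℝ) (hρ : 0 < ρ) (hρr : ρ < r) (χ : ℝ → ℝ)
    (hχ_one : ∀ t, 0 ≤ t → t ≤ ρ → χ t = 1) (hχ_zero : ∀ t, r ≤ t → χ t = 0) (n : ℤ) :
    ∃ vP vM : Plane → ℂ,
      (Continuous vP ∧ LatticePeriodic a vP ∧ vP =ᵐ[volume] uP) ∧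
      (Continuous vM ∧ LatticePeriodic a vM ∧ vM =ᵐ[volume] uM) ∧
      (n ≠ 0 → ContDiffOn ℝ 2 χ (Set.Ici 0) →
        ∃ R > 0, ∃ c > 0, ∀ x : Plane, R ≤ ‖x‖ →
          ‖canonicalWannier a k₀ r χ n vP vM x‖ ≤ c / ‖x‖ ^ 2) ∧
      (∀ (j : Fin 2) (p : ℕ), p = 0 ∨ p = 1 → ContDiffOn ℝ (p + 2) χ (Set.Ici 0) →
        ∃ R > 0, ∃ c > 0, ∀ x : Plane, R ≤ ‖x‖ →
          ‖weightedWannier a k₀ r χ n j p vP vM x‖ ≤ c / ‖x‖ ^ (p + 2)) := by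
  obtain ⟨DP, D2P, hPs, -⟩ := hP
  obtain ⟨DM, D2M, hMs, -⟩ := hM
  obtain ⟨vP, hvP, CP, hCP⟩ := BlochSobolev.exists_continuous_representative a hPs
  obtain ⟨vM, hvM, CM, hCM⟩ := BlochSobolev.exists_continuous_representative a hMs
  refine ⟨vP, vM, hvP, hvM, fun _ hχ => ?_, fun j p _ hχ => ?_⟩
  · simp only [CanonicalWannier.canonicalWannier_eq hχ_zero]
    exact CanonicalWannier.exists_norm_weightedWannier_le hCP hCM hρ hρr hχ_one hχ_zero 0 0
      (by exact_mod_cast hχ)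
  · exact CanonicalWannier.exists_norm_weightedWannier_le hCP hCM hρ hρr hχ_one hχ_zero j p
      (by exact_mod_cast hχ)
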